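/- Let $t\ge 1$ be an integer. A \emph{convention} for the threshold $t$ in a finite simple graph $g$ with node set $N$ is a set $S\subseteq N$ such that every $i\in S$ has at least $t$ neighbors in $S$ and every $i\in N\setminus S$ has strictly fewer than $t$ neighbors in $S$. Let $C(t,g)$ be the $\sigma$-algebra on $N$ generated by all conventions for $t$ in $g$; its atoms are its minimal nonempty sets. For each $n$ let a stochastic block model on $N=\{1,\dots,n\}$ be given: the nodes are partitioned into nonempty blocks indexed by a set $J(n)$ of types, and there are probabilities $p_{jj'}(n)=p_{j'j}(n)\in[0,1]$ for $j,j'\in J(n)$. Let $g^n$ be the random graph on $N$ in which any two distinct nodes, of types $j$ and $j'$, are linked with probability $p_{jj'}(n)$, independently across all pairs of nodes. Suppose that there is $\varepsilon>0$ such that, for all sufficiently large $n$, $$p_{jj'}(n)>(1+\varepsilon)\left(\frac{t\log n}{n}\right)^{1/t}\qquad\text{for all } j,j'\in J(n).$$ Then, with probability tending to $1$ as $n\to\infty$, the graph $g^n$ has no isolated nodes and the whole node set $N$ is the only atom of $C(t,g^n)$. -/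

import Mathlib

/-! ### Conventions for an absolute threshold, and the atoms they generate -/

section Conventions

variable {V : Type*}

/-- `S` is a convention of the network `G` for the absolute threshold `t`: every member of `S` has
at least `t` neighbors in `S`, and every node outside `S` has strictly fewer than `t` neighbors
in `S`. -/
def IsConvention (t : ℕ) (G : SimpleGraph V) (S : Set V) : Prop :=
  (∀ i ∈ S, t ≤ (G.neighborSet i ∩ S).ncard) ∧ (∀ i ∉ S, (G.neighborSet i ∩ S).ncard < t)

/-- `C(t, G)`: the `σ`-algebra on the nodes generated by all conventions for the threshold `t`. -/
abbrev conventionAlgebra (t : ℕ) (G : SimpleGraph V) : MeasurableSpace V :=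
  MeasurableSpace.generateFrom {S | IsConvention t G S}

/-- The atoms of `C(t, G)`, i.e. its minimal nonempty sets. -/
def conventionAtoms (t : ℕ) (G : SimpleGraph V) : Set (Set V) :=
  {A | Minimal (fun B : Set V => @MeasurableSet V (conventionAlgebra t G) B ∧ B.Nonempty) A}

end Conventions

/-! ### Stochastic block models -/

/-- A stochastic block model on the nodes `Fin n`: a partition of the nodes into blocks, given as
the fibers of a surjective map to a set of types, and a symmetric matrix of link probabilities
indexed by the types. -/
structure StochasticBlockModel (n : ℕ) where
  /-- The set of types. -/
  J : Type
  /-- The type of each node. -/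
  type : Fin n → J
  type_surjective : Function.Surjective type
  /-- `p j j'` is the probability of a link between a node of type `j` and a node of type `j'`. -/
  p : J → J → unitInterval
  p_symm : ∀ j j', p j j' = p j' j

namespace StochasticBlockModel

variable {n : ℕ}

/-- The link probability of an unordered pair of nodes. -/
def linkProb (M : StochasticBlockModel n) : Sym2 (Fin n) → unitInterval :=
  Sym2.lift ⟨fun i i' => M.p (M.type i) (M.type i'), fun _ _ => M.p_symm _ _⟩

/-- The law of the random network of the model: each pair of distinct nodes is linked with its
link probability, independently across all pairs. (`SimpleGraph.fromEdgeSet` discards the diagonal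
pairs, so no node is linked to itself.) -/
noncomputable def graphLaw (M : StochasticBlockModel n) :
    MeasureTheory.Measure (SimpleGraph (Fin n)) :=
  (MeasureTheory.Measure.pi fun e : Sym2 (Fin n) =>
    ProbabilityTheory.bernoulliMeasure True False (M.linkProb e)).map
      fun ω => SimpleGraph.fromEdgeSet {e | ω e}

end StochasticBlockModel

/-! It suffices that, with high probability, every `S` with `t ≤ |S| < n` recruits: some node
outside `S` has `t` neighbors in `S`. Then only `∅` and `N` can be conventions
(`forall_exists_adj_and_conventionAtoms_eq`).

For fixed `S`, cut `S` into parts `Q` of size between `t` and `2t + 1`, each with a core of `t - 1`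
nodes. An outside node linked to the whole core of some `Q` and to one further node of `Q` is
recruited. These star events, one for each pair of an outside node and a part, use disjoint sets of
links, so they are independent, and each has probability at least about `|Q| q ^ t / t`. Hence `S`
fails to recruit with probability at most `exp (-(1 - o(1)) (q ^ t / t) |S| (n - |S|))`
(`measureReal_pi_bernoulli_forall_notMem_card_lt_le`).

At the assumed threshold `q ^ t / t` is at least `(1 + ε) log n / n`, so the union bound over `S` is
the cut count for connectivity of a random graph above its threshold, which vanishes
(`tendsto_sum_choose_mul_exp`). -/

open MeasureTheory ProbabilityTheory Filter Topology

/-! ### Independence of events on disjoint coordinates. -/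

section ProductMeasure

variable {ι : Type*} [Fintype ι] {Ω : ι → Type*} [∀ i, MeasurableSpace (Ω i)]
  [∀ i, Finite (Ω i)] [∀ i, DiscreteMeasurableSpace (Ω i)]

/-- Under a product measure, events depending on disjoint sets of coordinates are independent. -/
theorem measureReal_pi_inter_of_dependsOn (μ : ∀ i, Measure (Ω i))
    [∀ i, IsProbabilityMeasure (μ i)] {A B : Set (∀ i, Ω i)} {F G : Finset ι}
    (hFG : Disjoint F G) (hA : DependsOn (· ∈ A) (F : Set ι)) (hB : DependsOn (· ∈ B) (G : Set ι)) :
    (Measure.pi μ).real (A ∩ B) = (Measure.pi μ).real A * (Measure.pi μ).real B := by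
  have hind : iIndepFun (fun i (ω : ∀ i, Ω i) ↦ ω i) (Measure.pi μ) :=
    iIndepFun_pi (X := fun i (x : Ω i) ↦ x) fun i ↦ aemeasurable_id
  have h := hind.indepFun_finset F G hFG fun i ↦ measurable_pi_apply i
  -- An event that depends only on `F` is the preimage of its own projection to `F`.
  have key : ∀ {A : Set (∀ i, Ω i)} {F : Finset ι}, DependsOn (· ∈ A) (F : Set ι) →
      (fun ω (i : F) ↦ ω i) ⁻¹' ((fun ω (i : F) ↦ ω i) '' A) = A := by
    intro A F hA
    refine Set.Subset.antisymm ?_ (Set.subset_preimage_image _ _)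
    rintro ω ⟨ω', hω', h⟩
    exact (hA fun i hi ↦ congrFun h ⟨i, hi⟩).mp hω'
  have := h.measure_inter_preimage_eq_mul _ _
    (MeasurableSet.of_discrete (s := (fun ω (i : F) ↦ ω i) '' A))
    (MeasurableSet.of_discrete (s := (fun ω (i : G) ↦ ω i) '' B))
  rw [key hA, key hB] at this
  simp [measureReal_def, this]

theorem measureReal_pi_biInter_of_dependsOn {κ : Type*} (μ : ∀ i, Measure (Ω i))
    [∀ i, IsProbabilityMeasure (μ i)] (s : Finset κ) {A : κ → Set (∀ i, Ω i)} {F : κ → Finset ι}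
    (hF : (s : Set κ).PairwiseDisjoint F)
    (hA : ∀ k ∈ s, DependsOn (· ∈ A k) (F k : Set ι)) :
    (Measure.pi μ).real (⋂ k ∈ s, A k) = ∏ k ∈ s, (Measure.pi μ).real (A k) := by
  classical
  induction s using Finset.induction_on with
  | empty => simp
  | insert a s ha ih =>
    rw [Finset.prod_insert ha, Finset.set_biInter_insert,
      measureReal_pi_inter_of_dependsOn μ (F := F a) (G := s.biUnion F) _ (hA a (by simp)),
      ih (hF.subset (by simp)) fun k hk ↦ hA k (by simp [hk])]
    · intro x y hxy
      simp only [Set.mem_iInter, eq_iff_iff]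
      refine forall₂_congr fun k hk ↦ (hA k (by simp [hk]) fun i hi ↦ hxy i ?_).to_iff
      simp only [Finset.coe_biUnion, Set.mem_iUnion]
      exact ⟨k, hk, hi⟩
    · rw [Finset.disjoint_biUnion_right]
      intro k hk
      exact hF (by simp) (by simp [hk]) (by rintro rfl; exact ha hk)

end ProductMeasure

/-! ### Probability of a single star. -/

section Bernoulli

variable {ι : Type*} [Fintype ι]

theorem measureReal_pi_bernoulli_forall_and_forall_not (p : ι → unitInterval) {C R : Finset ι}
    (hCR : Disjoint C R) :
    (Measure.pi fun e ↦ bernoulliMeasure True False (p e)).real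
      {ω | (∀ e ∈ C, ω e) ∧ ∀ e ∈ R, ¬ ω e}
      = (∏ e ∈ C, (p e : ℝ)) * ∏ e ∈ R, (1 - (p e : ℝ)) := by
  classical
  have hset : {ω : ι → Prop | (∀ e ∈ C, ω e) ∧ ∀ e ∈ R, ¬ ω e}
      = Set.univ.pi fun e ↦ {x : Prop | (e ∈ C → x) ∧ (e ∈ R → ¬ x)} := by
    ext ω
    simp only [Set.mem_ofPred_eq, Set.mem_pi, Set.mem_univ, true_implies, forall_and]
  rw [hset, measureReal_def, Measure.pi_pi, ENNReal.toReal_prod]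
  have hterm : ∀ e, (bernoulliMeasure True False (p e)
      {x : Prop | (e ∈ C → x) ∧ (e ∈ R → ¬ x)}).toReal
      = (if e ∈ C then (p e : ℝ) else 1) * (if e ∈ R then 1 - (p e : ℝ) else 1) := by
    intro e
    rw [← measureReal_def, bernoulliMeasure_real_apply _ MeasurableSet.of_discrete]
    have : e ∈ C → e ∉ R := fun h ↦ Finset.disjoint_left.mp hCR h
    by_cases h1 : e ∈ C <;> by_cases h2 : e ∈ R <;> simp_all
  simp_rw [hterm, Finset.prod_mul_distrib]
  simp

/-- A crude second-order Bonferroni bound, with `r ^ 2` in place of `r.choose 2`; it yields `1 - (1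
- q) ^ r ≥ r q (1 - r q)`. -/
theorem one_sub_pow_le {q : ℝ} (hq : 0 ≤ q) (hq' : q ≤ 1) (r : ℕ) :
    (1 - q) ^ r ≤ 1 - r * q + r ^ 2 * q ^ 2 := by
  induction r with
  | zero => simp
  | succ r ih =>
    have := mul_le_mul_of_nonneg_right ih (sub_nonneg.mpr hq')
    have h3 : 0 ≤ (r : ℝ) ^ 2 * q ^ 3 := by positivity
    have h2 : 0 ≤ (r : ℝ) * q ^ 2 := by positivity
    rw [pow_succ]
    push_cast
    nlinarith [sq_nonneg q]

/-- The star has probability `∏_C p · (1 - ∏_R (1 - p))`, bounded below termwise by `q`; then `1 - x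
≤ exp (-x)`. The exponential form turns products over independent stars into sums. -/
theorem measureReal_pi_bernoulli_not_star_le (p : ι → unitInterval) {C R : Finset ι}
    (hCR : Disjoint C R) {q : ℝ} (hq : 0 ≤ q) (hC : ∀ e ∈ C, q ≤ p e) (hR : ∀ e ∈ R, q ≤ p e)
    (hR' : R.card * q ≤ 1) :
    (Measure.pi fun e ↦ bernoulliMeasure True False (p e)).real
      {ω | ¬ ((∀ e ∈ C, ω e) ∧ ∃ e ∈ R, ω e)}
      ≤ Real.exp (-(q ^ C.card * (R.card * q * (1 - R.card * q)))) := by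
  classical
  set μ := Measure.pi fun e ↦ bernoulliMeasure True False (p e) with hμ
  have h1 := measureReal_pi_bernoulli_forall_and_forall_not p hCR
  have h2 := measureReal_pi_bernoulli_forall_and_forall_not p (Finset.disjoint_empty_right C)
  simp only [Finset.notMem_empty, false_imp_iff, implies_true, and_true, Finset.prod_empty,
    mul_one] at h2
  rw [← hμ] at h1 h2
  have hstar : {ω : ι → Prop | (∀ e ∈ C, ω e) ∧ ∃ e ∈ R, ω e}
      = {ω | ∀ e ∈ C, ω e} \ {ω | (∀ e ∈ C, ω e) ∧ ∀ e ∈ R, ¬ ω e} := by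
    ext ω
    simp only [Set.mem_ofPred_eq, Set.mem_sdiff, not_and, not_forall, not_not]
    grind
  have hs : μ.real {ω : ι → Prop | (∀ e ∈ C, ω e) ∧ ∃ e ∈ R, ω e}
      = (∏ e ∈ C, (p e : ℝ)) * (1 - ∏ e ∈ R, (1 - (p e : ℝ))) := by
    rw [hstar, measureReal_sdiff (fun ω h ↦ h.1) MeasurableSet.of_discrete, h1, h2]
    ring
  have hc : μ.real {ω : ι → Prop | ¬ ((∀ e ∈ C, ω e) ∧ ∃ e ∈ R, ω e)}
      = 1 - μ.real {ω : ι → Prop | (∀ e ∈ C, ω e) ∧ ∃ e ∈ R, ω e} := by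
    rw [← probReal_compl_eq_one_sub MeasurableSet.of_discrete]
    rfl
  have hCp : q ^ C.card ≤ ∏ e ∈ C, (p e : ℝ) := by
    rw [← Finset.prod_const]
    exact Finset.prod_le_prod (fun _ _ ↦ hq) hC
  have hRp : ∏ e ∈ R, (1 - (p e : ℝ)) ≤ 1 - R.card * q * (1 - R.card * q) := by
    rcases R.eq_empty_or_nonempty with rfl | ⟨e, he⟩
    · simp
    calc ∏ e ∈ R, (1 - (p e : ℝ)) ≤ (1 - q) ^ R.card := by
          rw [← Finset.prod_const]
          exact Finset.prod_le_prod (fun e _ ↦ sub_nonneg.mpr (p e).2.2)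
            fun e he ↦ by linarith [hR e he]
      _ ≤ 1 - R.card * q + (R.card : ℝ) ^ 2 * q ^ 2 :=
          one_sub_pow_le hq ((hR e he).trans (p e).2.2) _
      _ = _ := by ring
  have h0 : 0 ≤ (R.card : ℝ) * q * (1 - R.card * q) :=
    mul_nonneg (by positivity) (by linarith)
  have hprod : q ^ C.card * (R.card * q * (1 - R.card * q)) ≤
      (∏ e ∈ C, (p e : ℝ)) * (1 - ∏ e ∈ R, (1 - (p e : ℝ))) :=
    mul_le_mul hCp (by linarith) h0 (Finset.prod_nonneg fun e _ ↦ (p e).2.1)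
  have hexp := Real.add_one_le_exp (-(q ^ C.card * (R.card * q * (1 - R.card * q))))
  rw [hc, hs]
  linarith

end Bernoulli

/-! ### Reduction to recruitment by every large proper set. -/

section Conventions

variable {V : Type*}

theorem conventionAtoms_eq_singleton_univ [Nonempty V] {t : ℕ} {G : SimpleGraph V}
    (h : ∀ S, IsConvention t G S → S = ∅ ∨ S = Set.univ) :
    conventionAtoms t G = {Set.univ} := by
  have hmeas : ∀ B : Set V, MeasurableSet[conventionAlgebra t G] B ↔ B = ∅ ∨ B = Set.univ := by
    intro B
    have hbot : conventionAlgebra t G = ⊥ := by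
      refine le_bot_iff.mp (MeasurableSpace.generateFrom_le fun S hS ↦ ?_)
      exact MeasurableSpace.measurableSet_bot_iff.mpr (h S hS)
    rw [hbot, MeasurableSpace.measurableSet_bot_iff]
  ext A
  simp only [conventionAtoms, hmeas, Set.mem_ofPred_eq, Set.mem_singleton_iff]
  constructor
  · intro hA
    exact hA.prop.1.resolve_left hA.prop.2.ne_empty
  · rintro rfl
    refine ⟨⟨Or.inr rfl, Set.univ_nonempty⟩, fun B hB _ ↦ ?_⟩
    rw [hB.1.resolve_left hB.2.ne_empty]

theorem IsConvention.lt_ncard [Finite V] {t : ℕ} {G : SimpleGraph V} {S : Set V}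
    (hS : IsConvention t G S) (hne : S.Nonempty) : t < S.ncard := by
  obtain ⟨i, hi⟩ := hne
  refine (hS.1 i hi).trans_lt (Set.ncard_lt_ncard ⟨Set.inter_subset_right, fun h ↦ ?_⟩)
  exact G.loopless.irrefl i (h hi).1

/-- If every set of at least `t` nodes other than the whole node set can recruit a further node,
then no node is isolated and the whole node set is the only atom. -/
theorem forall_exists_adj_and_conventionAtoms_eq [Fintype V] [DecidableEq V] {t : ℕ} (ht : 0 < t)
    (hV : t < Fintype.card V) {G : SimpleGraph V}
    (h : ∀ S : Finset V, t ≤ S.card → S ≠ Finset.univ →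
      ∃ i ∉ S, t ≤ (G.neighborSet i ∩ S).ncard) :
    (∀ i, ∃ i', G.Adj i i') ∧ conventionAtoms t G = {Set.univ} := by
  classical
  have : Nonempty V := Fintype.card_pos_iff.mp (by omega)
  refine ⟨fun i ↦ ?_, conventionAtoms_eq_singleton_univ fun S hS ↦ ?_⟩
  -- The only node that `{i}ᶜ` can recruit is `i`, which therefore has `t ≥ 1` neighbors.
  · obtain ⟨j, hj, hj'⟩ := h {i}ᶜ (by rw [Finset.card_compl, Finset.card_singleton]; omega)
      (fun h ↦ by have := h ▸ Finset.mem_univ i; simp at this)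
    obtain rfl : j = i := by simpa using hj
    obtain ⟨k, hk⟩ := (Set.ncard_pos (Set.toFinite _)).mp (ht.trans_le hj')
    exact ⟨k, hk.1⟩
  · by_contra! hcon
    obtain ⟨hne, huniv⟩ := hcon
    have hcard := hS.lt_ncard hne
    obtain ⟨i, hi, hi'⟩ := h S.toFinset (by rw [← Set.ncard_eq_toFinset_card']; exact hcard.le)
      (by simpa using huniv)
    rw [Set.mem_toFinset] at hi
    rw [Set.coe_toFinset] at hi'
    exact absurd (hS.2 i hi) (by omega)

end Conventions

/-! ### Failure probability of one cut. -/

section Cuts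

variable {V : Type*} [DecidableEq V]

/-- Take an equipartition into `k = ⌊|S| / t⌋` parts: the average size is at least `t`, and `|S| < t
(k + 1) ≤ 2 t k` keeps it below `2 t`; rounding adds at most one. -/
theorem exists_finpartition_card_mem_Icc {S : Finset V} {t : ℕ} (ht : 0 < t) (hS : t ≤ S.card) :
    ∃ P : Finpartition S, ∀ Q ∈ P.parts, t ≤ Q.card ∧ Q.card ≤ 2 * t + 1 := by
  have h1 : S.card / t ≠ 0 := by
    rw [Nat.div_ne_zero_iff]
    exact ⟨ht.ne', hS⟩
  obtain ⟨P, hP, hcard⟩ := Finpartition.exists_equipartition_card_eq S h1 (Nat.div_le_self _ _)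
  refine ⟨P, fun Q hQ ↦ ⟨le_trans ?_ (hP.average_le_card_part hQ),
    (hP.card_part_le_average_add_one hQ).trans ?_⟩⟩
  · rw [hcard, Nat.le_div_iff_mul_le (by omega)]
    exact Nat.mul_div_le _ _
  · rw [hcard]
    have h2 : S.card < t * (S.card / t + 1) := Nat.lt_mul_div_succ _ ht
    have : S.card / (S.card / t) ≤ 2 * t := by
      rw [← Nat.lt_succ_iff, Nat.div_lt_iff_lt_mul (by omega)]
      have : 1 ≤ S.card / t := by omega
      nlinarith
    omega

variable [Fintype V]

/-- A link across the cut determines its endpoint outside `S`, and its endpoint inside `S`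
determines the part. -/
theorem pairwiseDisjoint_image_sym2_mk {S : Finset V} (P : Finpartition S) :
    ((Sᶜ ×ˢ P.parts : Finset (V × Finset V)) : Set (V × Finset V)).PairwiseDisjoint
      fun k ↦ k.2.image (s(k.1, ·)) := by
  rintro ⟨i, Q⟩ hk ⟨i', Q'⟩ hk' hne
  simp only [Finset.coe_product, Set.mem_prod, Finset.mem_coe, Finset.mem_compl] at hk hk'
  rw [Function.onFun, Finset.disjoint_left]
  intro e he he'
  simp only [Finset.mem_image] at he he'
  obtain ⟨a, ha, rfl⟩ := he
  obtain ⟨b, hb, hab⟩ := he'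
  have haS := P.le hk.2 ha
  have hbS := P.le hk'.2 hb
  rw [Sym2.eq_iff] at hab
  rcases hab with ⟨rfl, rfl⟩ | ⟨rfl, rfl⟩
  · exact hne (Prod.ext rfl (P.disjoint.elim_finset hk.2 hk'.2 _ ha hb))
  · exact hk'.1 haS

/-- In a random graph with independent links of probability at least `q`, the probability that no
node outside `S` has `t` neighbors in `S` decays exponentially in the size of the cut. -/
theorem measureReal_pi_bernoulli_forall_notMem_card_lt_le (p : Sym2 V → unitInterval) {t : ℕ}
    (ht : 0 < t) {q : ℝ} (hq : 0 ≤ q) (hq' : (t + 2) * q ≤ 1) (S : Finset V) (hS : t ≤ S.card)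
    (hp : ∀ i ∉ S, ∀ j ∈ S, q ≤ p s(i, j)) :
    (Measure.pi fun e ↦ bernoulliMeasure True False (p e)).real
      {ω | ∀ i ∉ S, ∀ T ⊆ S, (∀ j ∈ T, ω s(i, j)) → T.card < t}
      ≤ Real.exp (-(q ^ t / t * (1 - (t + 2) * q) *
          (S.card * ((Fintype.card V : ℝ) - S.card)))) := by
  obtain ⟨P, hP⟩ := exists_finpartition_card_mem_Icc ht hS
  -- The core is defined for every `Q` so that it can be chosen as a function; outside `P.parts` it
  -- is the unused default `∅`.
  have hcore : ∀ Q : Finset V, ∃ C ⊆ Q, Q ∈ P.parts → C.card = t - 1 := by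
    intro Q
    by_cases hQ : Q ∈ P.parts
    · obtain ⟨C, hC, hC'⟩ := Finset.exists_subset_card_eq (s := Q) (n := t - 1)
        (by have := (hP Q hQ).1; omega)
      exact ⟨C, hC, fun _ ↦ hC'⟩
    · exact ⟨∅, by simp, fun h ↦ absurd h hQ⟩
  choose C hCQ hCcard using hcore
  have hinj : ∀ i : V, Function.Injective fun j ↦ s(i, j) := fun i j j' h ↦
    Sym2.congr_right.mp h
  set D : V × Finset V → Set (Sym2 V → Prop) := fun k ↦
    {ω | ¬ ((∀ e ∈ (C k.2).image (s(k.1, ·)), ω e) ∧ ∃ e ∈ (k.2 \ C k.2).image (s(k.1, ·)), ω e)}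
    with hD
  -- A star at `i` would give `i` the `(t - 1) + 1 = t` neighbors `insert r (C Q)` in `S`.
  have hsub : {ω : Sym2 V → Prop | ∀ i ∉ S, ∀ T ⊆ S, (∀ j ∈ T, ω s(i, j)) → T.card < t}
      ⊆ ⋂ k ∈ Sᶜ ×ˢ P.parts, D k := by
    intro ω hω
    simp only [Set.mem_iInter, Prod.forall, Finset.mem_product, Finset.mem_compl, and_imp]
    rintro i Q hi hQ ⟨hall, e, he, hωe⟩
    simp only [Finset.mem_image, Finset.mem_sdiff] at he hall
    obtain ⟨r, ⟨hrQ, hrC⟩, rfl⟩ := he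
    have := hω i hi (insert r (C Q))
      (Finset.insert_subset (P.le hQ hrQ) ((hCQ Q).trans (P.le hQ))) (by
        intro j hj
        rcases Finset.mem_insert.mp hj with rfl | hj
        · exact hωe
        · exact hall _ ⟨j, hj, rfl⟩)
    rw [Finset.card_insert_of_notMem hrC, hCcard Q hQ] at this
    omega
  refine (measureReal_mono hsub).trans ?_
  rw [measureReal_pi_biInter_of_dependsOn _ _ (pairwiseDisjoint_image_sym2_mk P)]
  · have hfactor : ∀ k ∈ Sᶜ ×ˢ P.parts,
        (Measure.pi fun e ↦ bernoulliMeasure True False (p e)).real (D k)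
          ≤ Real.exp (-(q ^ t / t * (1 - (t + 2) * q) * k.2.card)) := by
      rintro ⟨i, Q⟩ hk
      simp only [Finset.mem_product, Finset.mem_compl] at hk
      obtain ⟨hi, hQ⟩ := hk
      obtain ⟨hQ1, hQ2⟩ := hP Q hQ
      have hRcard : (Q \ C Q).card = Q.card - (t - 1) := by
        rw [Finset.card_sdiff_of_subset (hCQ Q), hCcard Q hQ]
      -- `(2t + 1) - (t - 1) = t + 2`: bounded parts keep the second-order loss of order `q`.
      have hR2 : ((Q \ C Q).card : ℝ) ≤ t + 2 := by
        exact_mod_cast (show (Q \ C Q).card ≤ t + 2 by omega)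
      -- With `|Q| = t + m` this is `t + m ≤ t (m + 1)`. Each part thus contributes in proportion to
      -- its size, and nothing is lost when `t` does not divide `|S|`.
      have hR3 : (Q.card : ℝ) ≤ t * (Q \ C Q).card := by
        obtain ⟨m, hm⟩ := Nat.exists_eq_add_of_le hQ1
        rw [hRcard]
        have : Q.card ≤ t * (Q.card - (t - 1)) := by
          rw [hm, show t + m - (t - 1) = m + 1 by omega]
          nlinarith
        exact_mod_cast this
      have hmem : ∀ T ⊆ Q, ∀ e ∈ T.image (s(i, ·)), q ≤ p e := by
        intro T hT e he
        obtain ⟨j, hj, rfl⟩ := Finset.mem_image.mp he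
        exact hp i hi j (P.le hQ (hT hj))
      have hRq : ((Q \ C Q).card : ℝ) * q ≤ (t + 2) * q := by gcongr
      have := measureReal_pi_bernoulli_not_star_le p
        (C := (C Q).image (s(i, ·))) (R := (Q \ C Q).image (s(i, ·)))
        ((Finset.disjoint_image (hinj i)).mpr Finset.disjoint_sdiff) hq
        (hmem _ (hCQ Q)) (hmem _ Finset.sdiff_subset)
        (by rw [Finset.card_image_of_injective _ (hinj i)]; linarith)
      refine this.trans (Real.exp_le_exp.mpr (neg_le_neg ?_))
      rw [Finset.card_image_of_injective _ (hinj i), Finset.card_image_of_injective _ (hinj i),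
        hCcard Q hQ]
      have ht' : (0 : ℝ) < t := by exact_mod_cast ht
      calc q ^ t / t * (1 - (t + 2) * q) * Q.card
          ≤ q ^ t / t * (1 - (Q \ C Q).card * q) * (t * (Q \ C Q).card) := by
            gcongr
            exact mul_nonneg (by positivity) (by linarith)
        _ = q ^ (t - 1 + 1) * (1 - (Q \ C Q).card * q) * (Q \ C Q).card := by
            rw [Nat.sub_add_cancel ht]
            field_simp
        _ = _ := by rw [pow_succ]; ring
    refine (Finset.prod_le_prod (fun _ _ ↦ measureReal_nonneg) hfactor).trans (le_of_eq ?_)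
    rw [← Real.exp_sum, Finset.sum_neg_distrib, ← Finset.mul_sum,
      Finset.sum_product' (f := fun _ Q ↦ ((Finset.card Q : ℕ) : ℝ)), Finset.sum_const,
      Finset.card_compl, nsmul_eq_mul, Nat.cast_sub (Finset.card_le_univ S), ← Nat.cast_sum,
      P.sum_card_parts, mul_comm ((Fintype.card V : ℝ) - _)]
  · rintro ⟨i, Q⟩ - ω ω' hωω'
    have key : ∀ T ⊆ Q, ∀ e ∈ T.image (s(i, ·)), ω e = ω' e := fun T hT e he ↦
      hωω' e (Finset.image_subset_image hT he)
    simp only [hD, Set.mem_ofPred_eq]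
    congr 2
    · exact propext (forall₂_congr fun e he ↦ (key _ (hCQ Q) e he).to_iff)
    · refine propext (exists_congr fun e ↦ and_congr_right fun he ↦ ?_)
      exact (key _ Finset.sdiff_subset e he).to_iff

end Cuts

/-! ### The union bound over cuts. -/

section Asymptotics

/-- Two regimes. If `j ≤ n / L`, then `n.choose j ≤ n ^ j` and `(n - j) / n ≥ 1 - 1 / L`. Otherwise
`n.choose j ≤ 2 ^ n ≤ 2 ^ (j L)` and `(n - j) / n ≥ 1 / 2`. Adding both bases gives a single
geometric bound. -/
theorem choose_mul_exp_le {n j L : ℕ} (hn : 0 < n) (hL : 0 < L) (hj : 2 * j ≤ n) {B : ℝ}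
    (hB : 0 ≤ B) :
    (n.choose j : ℝ) * Real.exp (-(B * Real.log n * (j * (n - j) / n)))
      ≤ (Real.exp (-((B * (1 - 1 / L) - 1) * Real.log n))
          + 2 ^ L * Real.exp (-(B / 2 * Real.log n))) ^ j := by
  have hn' : (0 : ℝ) < n := by exact_mod_cast hn
  have hL' : (0 : ℝ) < L := by exact_mod_cast hL
  have hj' : 2 * (j : ℝ) ≤ n := by exact_mod_cast hj
  have hlog : 0 ≤ Real.log n := Real.log_natCast_nonneg n
  have hBl : 0 ≤ B * Real.log n := mul_nonneg hB hlog
  rcases le_or_gt (j * L) n with h | h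
  · have h' : (j : ℝ) * L ≤ n := by exact_mod_cast h
    have hfrac : (j : ℝ) * (1 - 1 / L) ≤ j * (n - j) / n := by
      rw [mul_div_assoc]
      gcongr
      rw [sub_div, div_self hn'.ne']
      gcongr 1 - ?_
      rw [div_le_div_iff₀ hn' hL']
      linarith
    calc (n.choose j : ℝ) * Real.exp (-(B * Real.log n * (j * (n - j) / n)))
        ≤ (n : ℝ) ^ j * Real.exp (-(B * Real.log n * (j * (1 - 1 / L)))) := by
          gcongr
          exact_mod_cast Nat.choose_le_pow n j
      _ = Real.exp (-((B * (1 - 1 / L) - 1) * Real.log n)) ^ j := by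
          rw [← Real.exp_log hn', ← Real.exp_nat_mul, ← Real.exp_nat_mul, ← Real.exp_add,
            Real.log_exp]
          congr 1
          ring
      _ ≤ _ := by
          gcongr
          linarith [show 0 ≤ 2 ^ L * Real.exp (-(B / 2 * Real.log n)) by positivity]
  · have hfrac : (j : ℝ) / 2 ≤ j * (n - j) / n := by
      rw [mul_div_assoc, div_eq_mul_inv]
      gcongr
      rw [inv_eq_one_div, div_le_div_iff₀ two_pos hn']
      linarith
    calc (n.choose j : ℝ) * Real.exp (-(B * Real.log n * (j * (n - j) / n)))
        ≤ (2 : ℝ) ^ (j * L) * Real.exp (-(B * Real.log n * (j / 2))) := by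
          gcongr
          exact_mod_cast (Nat.choose_le_two_pow n j).trans
            (Nat.pow_le_pow_right two_pos h.le)
      _ = (2 ^ L * Real.exp (-(B / 2 * Real.log n))) ^ j := by
          rw [mul_pow, ← Real.exp_nat_mul, ← pow_mul, mul_comm L j]
          congr 2
          ring
      _ ≤ _ := by
          gcongr
          linarith [Real.exp_pos (-((B * (1 - 1 / L) - 1) * Real.log n))]

theorem sum_range_pow_succ_le {x : ℝ} (hx : 0 ≤ x) (hx' : x ≤ 1 / 2) (n : ℕ) :
    ∑ k ∈ Finset.range n, x ^ (k + 1) ≤ 2 * x := by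
  have h := mul_neg_geom_sum x n
  have h0 : 0 ≤ ∑ k ∈ Finset.range n, x ^ k := Finset.sum_nonneg fun _ _ ↦ by positivity
  have hxn : 0 ≤ x ^ n := by positivity
  have h2 : ∑ k ∈ Finset.range n, x ^ k ≤ 2 := by nlinarith
  simp_rw [pow_succ, ← Finset.sum_mul]
  nlinarith

/-- The expected number of disconnecting cuts, weighted as in a random graph whose link
probability exceeds the connectivity threshold by a factor `B > 1`, is asymptotically negligible. -/
theorem tendsto_sum_choose_mul_exp {B : ℝ} (hB : 1 < B) :
    Tendsto (fun n : ℕ ↦ ∑ k ∈ Finset.range (n - 1), ((n.choose (k + 1) : ℕ) : ℝ) *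
      Real.exp (-(B * Real.log n * (((k + 1 : ℕ) : ℝ) * (n - (k + 1 : ℕ)) / n)))) atTop (𝓝 0) := by
  -- This choice of `L` is exactly what makes `B (1 - 1 / L) > 1`.
  obtain ⟨L, hL⟩ := exists_nat_gt (B / (B - 1))
  have hB1 : 0 < B - 1 := by linarith
  have hL' : (0 : ℝ) < L := lt_trans (by positivity) hL
  have hδ : 0 < B * (1 - 1 / L) - 1 := by
    rw [div_lt_iff₀ hB1] at hL
    have : B / L < B - 1 := by rw [div_lt_iff₀ hL']; linarith
    have h2 : B * (1 - 1 / L) = B - B / L := by ring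
    linarith
  set x : ℕ → ℝ := fun n ↦ Real.exp (-((B * (1 - 1 / L) - 1) * Real.log n))
          + 2 ^ L * Real.exp (-(B / 2 * Real.log n)) with hx
  have hlog : Tendsto (fun n : ℕ ↦ Real.log n) atTop atTop :=
    Real.tendsto_log_atTop.comp tendsto_natCast_atTop_atTop
  have hexp : ∀ {c : ℝ}, 0 < c →
      Tendsto (fun n : ℕ ↦ Real.exp (-(c * Real.log n))) atTop (𝓝 0) := fun hc ↦
    Real.tendsto_exp_neg_atTop_nhds_zero.comp (hlog.const_mul_atTop hc)
  have hx0 : Tendsto x atTop (𝓝 0) := by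
    rw [hx, show (0 : ℝ) = 0 + 2 ^ L * 0 by simp]
    exact (hexp hδ).add ((hexp (show 0 < B / 2 by linarith)).const_mul (2 ^ L))
  have hxpos : ∀ n, 0 ≤ x n := fun n ↦ by positivity
  refine squeeze_zero' (g := fun n ↦ 4 * x n)
    (Eventually.of_forall fun n ↦ Finset.sum_nonneg fun _ _ ↦ by positivity) ?_
    (by simpa using hx0.const_mul 4)
  filter_upwards [hx0.eventually_le_const (show (0 : ℝ) < 1 / 2 by norm_num),
    eventually_gt_atTop 1] with n hxn hn
  -- The summand is symmetric under `j ↦ n - j`, with `j = k + 1`, so `x ^ j` or `x ^ (n - j)`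
  -- bounds it; keeping both avoids splitting the sum.
  have hterm : ∀ k ∈ Finset.range (n - 1), ((n.choose (k + 1) : ℕ) : ℝ) *
      Real.exp (-(B * Real.log n * (((k + 1 : ℕ) : ℝ) * (n - (k + 1 : ℕ)) / n)))
      ≤ x n ^ (k + 1) + x n ^ (n - 1 - 1 - k + 1) := by
    intro k hk
    rw [Finset.mem_range] at hk
    have hLn : 0 < L := by exact_mod_cast hL'
    rcases le_total (2 * (k + 1)) n with h | h
    · exact (choose_mul_exp_le (by omega) hLn h (by linarith)).trans
        (le_add_of_nonneg_right (pow_nonneg (hxpos n) _))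
    · have := choose_mul_exp_le (n := n) (j := n - (k + 1)) (by omega) hLn (by omega)
        (show 0 ≤ B by linarith)
      rw [Nat.choose_symm (by omega), Nat.cast_sub (by omega), sub_sub_cancel,
        mul_comm ((n : ℝ) - _)] at this
      rw [show n - 1 - 1 - k + 1 = n - (k + 1) by omega]
      exact this.trans (le_add_of_nonneg_left (pow_nonneg (hxpos n) _))
  refine (Finset.sum_le_sum hterm).trans ?_
  rw [Finset.sum_add_distrib, Finset.sum_range_reflect (fun k ↦ x n ^ (k + 1))]
  linarith [sum_range_pow_succ_le (hxpos n) hxn (n - 1)]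

end Asymptotics

/-! ### Transfer to the block model and conclusion. -/

namespace StochasticBlockModel

variable {n : ℕ}

instance (M : StochasticBlockModel n) : IsProbabilityMeasure M.graphLaw :=
  Measure.isProbabilityMeasure_map Measurable.of_discrete.aemeasurable

theorem one_sub_sum_le_graphLaw_real (M : StochasticBlockModel n) {t : ℕ} (ht : 0 < t) (hn : t < n)
    {q : ℝ} (hq : 0 ≤ q) (hq' : (t + 2) * q ≤ 1) (hp : ∀ j j', q ≤ M.p j j') :
    1 - ∑ k ∈ Finset.range (n - 1), ((n.choose (k + 1) : ℕ) : ℝ) *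
        Real.exp (-(q ^ t / t * (1 - (t + 2) * q) * (((k + 1 : ℕ) : ℝ) * (n - (k + 1 : ℕ)))))
      ≤ M.graphLaw.real {G : SimpleGraph (Fin n) |
          (∀ i, ∃ i', G.Adj i i') ∧ conventionAtoms t G = {Set.univ}} := by
  set μ := Measure.pi fun e : Sym2 (Fin n) ↦ bernoulliMeasure True False (M.linkProb e) with hμ
  -- Including `t ≤ S.card` in the event makes it empty for small `S`, so the union can run over all
  -- sizes from `1` to `n - 1`.
  set bad : Finset (Fin n) → Set (Sym2 (Fin n) → Prop) := fun S ↦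
    {ω | t ≤ S.card ∧ ∀ i ∉ S, ∀ T ⊆ S, (∀ j ∈ T, ω s(i, j)) → T.card < t} with hbad
  set U := ⋃ k ∈ Finset.range (n - 1), ⋃ S ∈ Finset.univ.powersetCard (k + 1), bad S with hU
  have hbound : μ.real U ≤ ∑ k ∈ Finset.range (n - 1), ((n.choose (k + 1) : ℕ) : ℝ) *
      Real.exp (-(q ^ t / t * (1 - (t + 2) * q) * (((k + 1 : ℕ) : ℝ) * (n - (k + 1 : ℕ))))) := by
    refine (measureReal_biUnion_finset_le _ _).trans (Finset.sum_le_sum fun k _ ↦ ?_)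
    refine (measureReal_biUnion_finset_le _ _).trans ((Finset.sum_le_card_nsmul _ _
      (Real.exp (-(q ^ t / t * (1 - (t + 2) * q) * (((k + 1 : ℕ) : ℝ) * (n - (k + 1 : ℕ)))))) ?_).trans
      (le_of_eq ?_))
    · intro S hS
      rw [Finset.mem_powersetCard_univ] at hS
      by_cases hcard : t ≤ S.card
      · refine (measureReal_mono fun ω hω ↦ hω.2).trans
          ((measureReal_pi_bernoulli_forall_notMem_card_lt_le M.linkProb ht hq hq' S hcard
            fun i _ j _ ↦ hp _ _).trans (le_of_eq ?_))
        rw [hS, Fintype.card_fin]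
      · have : bad S = ∅ := Set.eq_empty_of_forall_notMem fun ω hω ↦ hcard hω.1
        rw [this, measureReal_empty]
        positivity
    · rw [Finset.card_powersetCard, Finset.card_univ, Fintype.card_fin, nsmul_eq_mul]
  have hsub : Uᶜ ⊆ (fun ω : Sym2 (Fin n) → Prop ↦ SimpleGraph.fromEdgeSet {e | ω e}) ⁻¹'
      {G : SimpleGraph (Fin n) |
        (∀ i, ∃ i', G.Adj i i') ∧ conventionAtoms t G = {Set.univ}} := by
    intro ω hω
    refine forall_exists_adj_and_conventionAtoms_eq ht (by simpa using hn) fun S hS hSu ↦ ?_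
    have hlt : S.card < n := by
      simpa using Finset.card_lt_card (Finset.ssubset_univ_iff.mpr hSu)
    simp only [hU, Set.mem_compl_iff, Set.mem_iUnion, not_exists] at hω
    have := hω (S.card - 1) (Finset.mem_range.mpr (by omega)) S
      (Finset.mem_powersetCard_univ.mpr (by omega))
    simp only [hbad, Set.mem_ofPred_eq, not_and, not_forall, not_lt] at this
    obtain ⟨i, hi, T, hTS, hT, hTt⟩ := this hS
    refine ⟨i, hi, hTt.trans ?_⟩
    rw [← Set.ncard_coe_finset]
    refine Set.ncard_le_ncard (fun j hj ↦ ⟨?_, hTS hj⟩) (Set.toFinite _)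
    simp only [SimpleGraph.mem_neighborSet, SimpleGraph.fromEdgeSet_adj]
    exact ⟨hT j hj, by rintro rfl; exact hi (hTS hj)⟩
  calc _ ≤ 1 - μ.real U := by linarith
    _ = μ.real Uᶜ := (probReal_compl_eq_one_sub MeasurableSet.of_discrete).symm
    _ ≤ μ.real ((fun ω : Sym2 (Fin n) → Prop ↦ SimpleGraph.fromEdgeSet {e | ω e}) ⁻¹' _) :=
      measureReal_mono hsub
    _ ≤ _ := ENNReal.toReal_mono (measure_ne_top _ _)
      (Measure.le_map_apply Measurable.of_discrete.aemeasurable _)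

end StochasticBlockModel

theorem tendsto_mul_log_div_rpow {t : ℕ} (ht : 0 < t) :
    Tendsto (fun n : ℕ ↦ ((t : ℝ) * Real.log (n : ℝ) / (n : ℝ)) ^ ((1 : ℝ) / (t : ℝ)))
      atTop (𝓝 0) := by
  have h1 : Tendsto (fun n : ℕ ↦ Real.log (n : ℝ) / (n : ℝ)) atTop (𝓝 0) :=
    (Real.isLittleO_log_id_atTop.tendsto_div_nhds_zero).comp tendsto_natCast_atTop_atTop
  have h2 : Tendsto (fun n : ℕ ↦ (t : ℝ) * Real.log (n : ℝ) / (n : ℝ)) atTop (𝓝 0) := by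
    simpa [mul_div_assoc] using h1.const_mul (t : ℝ)
  have ht' : (0 : ℝ) < 1 / t := by positivity
  simpa only [Real.zero_rpow ht'.ne'] using h2.rpow_const (p := (1 : ℝ) / t) (Or.inr ht'.le)

theorem theorem2 (t : ℕ) (ht : 0 < t) (M : ∀ n : ℕ, StochasticBlockModel n)
    (ε : ℝ) (hε : 0 < ε)
    (hp : ∀ᶠ n : ℕ in Filter.atTop, ∀ j j' : (M n).J,
      (1 + ε) * ((t : ℝ) * Real.log (n : ℝ) / (n : ℝ)) ^ ((1 : ℝ) / (t : ℝ))
        < ((M n).p j j' : ℝ)) :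
    Filter.Tendsto
      (fun n : ℕ => (M n).graphLaw.real
        {G : SimpleGraph (Fin n) |
          (∀ i, ∃ i', G.Adj i i') ∧ conventionAtoms t G = {Set.univ}})
      Filter.atTop (nhds 1) := by
  set q : ℕ → ℝ := fun n ↦
    (1 + ε) * ((t : ℝ) * Real.log (n : ℝ) / (n : ℝ)) ^ ((1 : ℝ) / (t : ℝ)) with hqdef
  have hq0 : Tendsto (fun n ↦ ((t : ℝ) + 2) * q n) atTop (𝓝 0) := by
    simpa only [mul_zero] using ((tendsto_mul_log_div_rpow ht).const_mul (1 + ε)).const_mul ((t : ℝ) + 2)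
  -- `(t + 2) q` below this value ensures `(1 + ε) (1 - (t + 2) q) ≥ 1 + ε / 2`: half of the margin
  -- pays for the second-order loss.
  have hsmall : 0 < (ε / 2) / (1 + ε) := by positivity
  have hlim := (tendsto_sum_choose_mul_exp (show 1 < 1 + ε / 2 by linarith)).const_sub 1
  rw [sub_zero] at hlim
  refine tendsto_of_tendsto_of_tendsto_of_le_of_le' hlim tendsto_const_nhds ?_
    (Eventually.of_forall fun n ↦ measureReal_le_one)
  filter_upwards [hp, hq0.eventually_lt_const hsmall, hq0.eventually_lt_const one_pos,
    eventually_gt_atTop t] with n hpn hqn hqn1 hn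
  have hnpos : (0 : ℝ) < n := by exact_mod_cast (show 0 < n by omega)
  have ht' : (0 : ℝ) < t := by exact_mod_cast ht
  have hlog : 0 ≤ Real.log n := Real.log_natCast_nonneg n
  have hbase : 0 ≤ (t : ℝ) * Real.log n / n := by positivity
  have hq : 0 ≤ q n := by positivity
  refine le_trans ?_ ((M n).one_sub_sum_le_graphLaw_real ht hn hq hqn1.le
    fun j j' ↦ (hpn j j').le)
  -- The `t` inside the threshold cancels the `1 / t` of the cut bound.
  have hqt : q n ^ t / t = (1 + ε) ^ t * (Real.log n / n) := by
    rw [hqdef]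
    simp only
    rw [mul_pow, one_div, Real.rpow_inv_natCast_pow hbase ht.ne']
    field_simp
  have hrate : (1 + ε / 2) * (Real.log n / n) ≤ q n ^ t / t * (1 - (t + 2) * q n) := by
    rw [lt_div_iff₀ (by linarith)] at hqn
    have h1 : 1 + ε ≤ (1 + ε) ^ t := le_self_pow₀ (by linarith) ht.ne'
    calc (1 + ε / 2) * (Real.log n / n)
        ≤ ((1 + ε) * (1 - (t + 2) * q n)) * (Real.log n / n) := by gcongr; linarith
      _ ≤ ((1 + ε) ^ t * (1 - (t + 2) * q n)) * (Real.log n / n) := by gcongr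
      _ = _ := by rw [hqt]; ring
  refine sub_le_sub_left (Finset.sum_le_sum fun k hk ↦ ?_) 1
  have hk' : ((k + 1 : ℕ) : ℝ) ≤ n := by
    have := Finset.mem_range.mp hk
    exact_mod_cast (show k + 1 ≤ n by omega)
  refine mul_le_mul_of_nonneg_left (Real.exp_le_exp.mpr (neg_le_neg ?_)) (Nat.cast_nonneg _)
  calc (1 + ε / 2) * Real.log n * (((k + 1 : ℕ) : ℝ) * (n - (k + 1 : ℕ)) / n)
      = (1 + ε / 2) * (Real.log n / n) * (((k + 1 : ℕ) : ℝ) * (n - (k + 1 : ℕ))) := by ring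
    _ ≤ _ := mul_le_mul_of_nonneg_right hrate (mul_nonneg (Nat.cast_nonneg _) (by linarith))
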